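/- Polar coordinates and the domain. Let $X(r,\theta)=(r\cos\theta,r\sin\theta)$. Let $\theta_0\in\mathbb R$, $r_*>0$, and let $r_1,r_2$ be positive continuous functions on $[\theta_0,\infty)$ with $$r_2(\theta+2\pi)<r_1(\theta)<r_2(\theta)\quad(\theta\ge\theta_0),\qquad \lim_{\theta\to\infty}r_1(\theta)=\lim_{\theta\to\infty}r_2(\theta)=r_*.$$ For $I\subset[\theta_0,\infty)$ and $\theta\ge\theta_0$ put $$U_I=\{X(r,\theta):\theta\in I,\ r_1(\theta)<r<r_2(\theta)\},\qquad \widetilde U_I=\{X(r,\theta):\theta\in I,\ r_1(\theta)\le r\le r_2(\theta)\},$$ $$\mathcal S_\theta=\{X(r,\theta): r_1(\theta)\le r\le r_2(\theta)\},\qquad \gamma=\bigcup_{i=1,2}\{X(r_i(\theta),\theta):\theta\ge\theta_0\}.$$ Let $\bar\theta\ge\theta_0$, $d_0>0$ and $\theta_*\in(0,\pi/2)$ be such that $$r_2(\theta)\le r_*+d_0\ \text{ for all }\theta\in[\bar\theta,\bar\theta+2\theta_*],\qquad \cos\theta_*<\frac{r_*}{r_*+d_0},$$ and set $\Omega=U_{(\bar\theta,\bar\theta+2\theta_*)}$,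 $\widetilde\gamma=\gamma\cap\widetilde U_{[\bar\theta,\bar\theta+2\theta_*]}$. The operator. Let $A=(a_{ij})$ be a function from $\Omega$ to the real symmetric $2\times2$ matrices, let $b:\Omega\to\mathbb R^2$, and $$Lu=-\sum_{i,j=1}^2 a_{ij}\frac{\partial^2u}{\partial x_i\partial x_j}+b\cdot\nabla u .$$ Assume that there are constants $c_0>0$, $M_1>0$, $M_2\ge0$ with $\xi^{\rm T}A(x)\xi\ge c_0|\xi|^2$, ${\rm Tr}\,A(x)\le M_1$ and $|b(x)|\le M_2$ for all $x\in\Omega$ and $\xi\in\mathbb R^2$. Write $u^+=\max\{0,u\}$. Claim. There is a number $\eta_*\in(0,1)$ such that every $u\in C^2(\Omega)\cap C(\overline\Omega)$ with $Lu\le0$ in $\Omega$ and $u\le0$ on $\widetilde\gamma$ satisfies $$\max_{\mathcal S_{\bar\theta+\theta_*}}u^+\le\eta_*\max\Big\{\max_{\mathcal S_{\bar\theta}}u^+,\ \max_{\mathcal S_{\bar\theta+2\theta_*}}u^+\Big\}.\tag{1}$$ More precisely, let $d_*$ and $s$ be any numbers with $$d_*\ge\max\Big\{(r_*+d_0)\Big(\frac1{\cos\theta_*}-1\Big),\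 \frac{d_0^2}{2[(r_*+d_0)(1-\cos\theta_*)-d_0]}\Big\},$$ $$s>0,\qquad s\ge\frac{M_1+M_2(r_*+d_0+d_*)}{c_0}-2,$$ and put $$\eta_*=1-\Big\{\Big(\frac{d_*}{d_*+d_0}\Big)^s-\Big(\frac{d_*}{\widehat d_*}\Big)^s\Big\},\qquad \widehat d_*=\sqrt{d_*^2+2d_*(r_*+d_0)(1-\cos\theta_*)}.$$ Then $0<\eta_*\le1$, and (1) holds with this $\eta_*$ for all such $u$. Moreover $\eta_*<1$ whenever $d_*>\dfrac{d_0^2}{2[(r_*+d_0)(1-\cos\theta_*)-d_0]}$. -/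

import Mathlib

open Set Filter Topology

/-- Polar coordinates `X(r, θ) = (r cos θ, r sin θ)` in the Euclidean plane. -/
noncomputable def polarX (r θ : ℝ) : EuclideanSpace ℝ (Fin 2) :=
  !₂[r * Real.cos θ, r * Real.sin θ]

/-- Standing assumptions on the two boundary curves `r = r₁(θ)`, `r = r₂(θ)`, `θ ≥ θ₀`:
they are positive and continuous, do not intersect themselves or each other while winding
around the origin, and both converge to the circle of radius `rs > 0`. -/
structure SpiralCurves (θ₀ rs : ℝ) (r₁ r₂ : ℝ → ℝ) : Prop where
  radius_pos : 0 < rs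
  pos₁ : ∀ θ, θ₀ ≤ θ → 0 < r₁ θ
  pos₂ : ∀ θ, θ₀ ≤ θ → 0 < r₂ θ
  cont₁ : ContinuousOn r₁ (Ici θ₀)
  cont₂ : ContinuousOn r₂ (Ici θ₀)
  next_lt : ∀ θ, θ₀ ≤ θ → r₂ (θ + 2 * Real.pi) < r₁ θ
  lt : ∀ θ, θ₀ ≤ θ → r₁ θ < r₂ θ
  tendsto₁ : Tendsto r₁ atTop (𝓝 rs)
  tendsto₂ : Tendsto r₂ atTop (𝓝 rs)

/-- `U_I = {X(r, θ) : θ ∈ I, r₁(θ) < r < r₂(θ)}`. -/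
def spiralPiece (r₁ r₂ : ℝ → ℝ) (I : Set ℝ) : Set (EuclideanSpace ℝ (Fin 2)) :=
  {x | ∃ r θ, θ ∈ I ∧ r₁ θ < r ∧ r < r₂ θ ∧ x = polarX r θ}

/-- `Ũ_I = {X(r, θ) : θ ∈ I, r₁(θ) ≤ r ≤ r₂(θ)}`. -/
def spiralPieceClosed (r₁ r₂ : ℝ → ℝ) (I : Set ℝ) : Set (EuclideanSpace ℝ (Fin 2)) :=
  {x | ∃ r θ, θ ∈ I ∧ r₁ θ ≤ r ∧ r ≤ r₂ θ ∧ x = polarX r θ}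

/-- The union `γ` of the two curves `{X(rᵢ(θ), θ) : θ ≥ θ₀}`, `i = 1, 2`. -/
def spiralBoundary (θ₀ : ℝ) (r₁ r₂ : ℝ → ℝ) : Set (EuclideanSpace ℝ (Fin 2)) :=
  {x | ∃ θ, θ₀ ≤ θ ∧ x = polarX (r₁ θ) θ} ∪ {x | ∃ θ, θ₀ ≤ θ ∧ x = polarX (r₂ θ) θ}

/-- The cross-section `S_θ = {X(r, θ) : r₁(θ) ≤ r ≤ r₂(θ)}`. -/
def crossSection (r₁ r₂ : ℝ → ℝ) (θ : ℝ) : Set (EuclideanSpace ℝ (Fin 2)) :=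
  {x | ∃ r, r₁ θ ≤ r ∧ r ≤ r₂ θ ∧ x = polarX r θ}

/-- The partial derivative `∂f/∂xᵢ` at `x`. -/
noncomputable def partialD {n : ℕ} (i : Fin n) (f : EuclideanSpace ℝ (Fin n) → ℝ)
    (x : EuclideanSpace ℝ (Fin n)) : ℝ :=
  fderiv ℝ f x (EuclideanSpace.single i 1)

/-- `Lu = - ∑ᵢⱼ aᵢⱼ ∂²u/∂xᵢ∂xⱼ + b · ∇u`. -/
noncomputable def ellipticOp {n : ℕ}
    (A : EuclideanSpace ℝ (Fin n) → Matrix (Fin n) (Fin n) ℝ)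
    (b : EuclideanSpace ℝ (Fin n) → EuclideanSpace ℝ (Fin n))
    (u : EuclideanSpace ℝ (Fin n) → ℝ) (x : EuclideanSpace ℝ (Fin n)) : ℝ :=
  -(∑ i, ∑ j, A x i j * partialD i (partialD j u) x) + ∑ i, b x i * partialD i u x

/-- `A` is symmetric on `Ω`, `ξᵀ A ξ ≥ c₀ |ξ|²` with `c₀ > 0`, and `Tr A ≤ M₁` with `M₁ > 0`. -/
structure EllipticOn {n : ℕ} (A : EuclideanSpace ℝ (Fin n) → Matrix (Fin n) (Fin n) ℝ)
    (Ω : Set (EuclideanSpace ℝ (Fin n))) (c₀ M₁ : ℝ) : Prop where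
  c_pos : 0 < c₀
  M_pos : 0 < M₁
  symm : ∀ x ∈ Ω, (A x).IsSymm
  lower : ∀ x ∈ Ω, ∀ ξ : EuclideanSpace ℝ (Fin n),
    c₀ * ‖ξ‖ ^ 2 ≤ ∑ i, ∑ j, ξ i * A x i j * ξ j
  trace_le : ∀ x ∈ Ω, (A x).trace ≤ M₁

/-- `|b| ≤ M₂` on `Ω`, with `M₂ ≥ 0`. -/
structure DriftBoundedOn {n : ℕ} (b : EuclideanSpace ℝ (Fin n) → EuclideanSpace ℝ (Fin n))
    (Ω : Set (EuclideanSpace ℝ (Fin n))) (M₂ : ℝ) : Prop where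
  M_nonneg : 0 ≤ M₂
  norm_le : ∀ x ∈ Ω, ‖b x‖ ≤ M₂

/-- `u ∈ C²(Ω) ∩ C(closure Ω)`, `Lu ≤ 0` in `Ω`, and `u ≤ 0` on `g`. -/
structure SubsolutionOn {n : ℕ} (A : EuclideanSpace ℝ (Fin n) → Matrix (Fin n) (Fin n) ℝ)
    (b : EuclideanSpace ℝ (Fin n) → EuclideanSpace ℝ (Fin n))
    (Ω g : Set (EuclideanSpace ℝ (Fin n))) (u : EuclideanSpace ℝ (Fin n) → ℝ) : Prop where
  contDiff : ContDiffOn ℝ 2 u Ω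
  cont : ContinuousOn u (closure Ω)
  op_nonpos : ∀ x ∈ Ω, ellipticOp A b u x ≤ 0
  nonpos : ∀ x ∈ g, u x ≤ 0

/-- `m` is the (attained) maximum over `S` of the positive part `u⁺ = max {0, u}`. -/
def IsMaxPosPart {E : Type*} (u : E → ℝ) (S : Set E) (m : ℝ) : Prop :=
  IsGreatest ((fun x => max 0 (u x)) '' S) m

/-- The three maxima of `u⁺` exist, and
`max_{S₁} u⁺ ≤ η · max {max_{S₀} u⁺, max_{S₂} u⁺}`. -/
def GrowthIneq {E : Type*} (u : E → ℝ) (S₀ S₁ S₂ : Set E) (η : ℝ) : Prop :=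
  ∃ m₀ m₁ m₂ : ℝ, IsMaxPosPart u S₀ m₀ ∧ IsMaxPosPart u S₁ m₁ ∧ IsMaxPosPart u S₂ m₂ ∧
    m₁ ≤ η * max m₀ m₂

/-- `d̂ = √(d² + 2 d (rs + d₀)(1 - cos θs))`. -/
noncomputable def dHat (rs d₀ θs d : ℝ) : ℝ :=
  Real.sqrt (d ^ 2 + 2 * d * (rs + d₀) * (1 - Real.cos θs))

/-- `η = 1 - {(d / (d + d₀))^s - (d / d̂)^s}`. -/
noncomputable def etaStar (rs d₀ θs d s : ℝ) : ℝ :=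
  1 - ((d / (d + d₀)) ^ s - (d / dHat rs d₀ θs d) ^ s)

/-! The proof compares `u` with a radial barrier. Put `R = rs + d₀` and place a pole `y` at radius
`R + d` on the middle ray `θb + θs`, outside the domain. For large `s` the function `|z - y|^(-s)`
is a strict subsolution: its radial second derivative contributes a multiple of `(s + 2) c₀`, which
beats the trace and drift terms, bounded through `M₁` and `M₂ |z - y|`
(`ellipticOp_rpow_norm_sq_neg`).

Let `m > 0` bound `u` on the two end sections and consider `w = u + m (d / |z - y|)^s`. On the
curves `u ≤ 0` and `|z - y| ≥ d`, so `w ≤ m`. On the end sections `u ≤ m` and `|z - y| ≥ d̂`, so `w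
≤ m (1 + (d / d̂)^s)`. The maximum principle (`le_of_ellipticOp_neg`) carries the larger bound
inside. On the middle section `|z - y| ≤ d + d₀`, and subtracting the barrier there leaves `u ≤ η
m`.

The first lower bound on `d` says `R ≤ (R + d) cos θs`; it gives `|z - y| ≤ R + d` and the estimate
by `d̂`. The second is equivalent to `d + d₀ ≤ d̂`, that is, to `η ≤ 1`. Equality in the condition
on `s`, and vanishing maxima, are reached by perturbing `s` and `m` by `ε` and letting `ε → 0`. -/

/-! ### The elliptic operator and the maximum principle -/

theorem partialD_partialD_eq {n : ℕ} {f : EuclideanSpace ℝ (Fin n) → ℝ}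
    {x : EuclideanSpace ℝ (Fin n)} (hf : ContDiffAt ℝ 2 f x) (i j : Fin n) :
    partialD i (partialD j f) x =
      fderiv ℝ (fderiv ℝ f) x (EuclideanSpace.single i 1) (EuclideanSpace.single j 1) := by
  have h : DifferentiableAt ℝ (fderiv ℝ f) x :=
    (hf.fderiv_right (m := 1) (by norm_num)).differentiableAt (by norm_num)
  have h2 := (h.hasFDerivAt.clm_apply
    (hasFDerivAt_const (EuclideanSpace.single j (1 : ℝ)) x)).fderiv
  change fderiv ℝ (fun z => fderiv ℝ f z (EuclideanSpace.single j 1)) x _ = _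
  rw [h2]
  simp

/-- The first-order identity is needed on a whole neighbourhood of `x` before it can be
differentiated again; being C² at `x` supplies it. -/
theorem ellipticOp_add_const_mul {n : ℕ}
    (A : EuclideanSpace ℝ (Fin n) → Matrix (Fin n) (Fin n) ℝ)
    (b : EuclideanSpace ℝ (Fin n) → EuclideanSpace ℝ (Fin n))
    {f g : EuclideanSpace ℝ (Fin n) → ℝ} {x : EuclideanSpace ℝ (Fin n)}
    (hf : ContDiffAt ℝ 2 f x) (hg : ContDiffAt ℝ 2 g x) (c : ℝ) :
    ellipticOp A b (fun z => f z + c * g z) x =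
      ellipticOp A b f x + c * ellipticOp A b g x := by
  have key : ∀ z, DifferentiableAt ℝ f z → DifferentiableAt ℝ g z → ∀ i,
      partialD i (fun z => f z + c * g z) z = partialD i f z + c * partialD i g z := by
    intro z h1 h2 i
    have := (h1.hasFDerivAt.add (h2.hasFDerivAt.const_mul c)).fderiv
    unfold partialD
    change fderiv ℝ (f + fun z => c * g z) z _ = _
    rw [this]
    simp
  have hd : ∀ {h : EuclideanSpace ℝ (Fin n) → ℝ}, ContDiffAt ℝ 2 h x →
      ∀ᶠ z in 𝓝 x, DifferentiableAt ℝ h z := by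
    intro h hh
    filter_upwards [hh.eventually (by simp)] with z hz
    exact hz.differentiableAt (by norm_num)
  have hp : ∀ {h : EuclideanSpace ℝ (Fin n) → ℝ}, ContDiffAt ℝ 2 h x →
      ∀ j, DifferentiableAt ℝ (partialD j h) x := by
    intro h hh j
    have h1 : DifferentiableAt ℝ (fderiv ℝ h) x :=
      (hh.fderiv_right (m := 1) (by norm_num)).differentiableAt (by norm_num)
    exact h1.clm_apply (differentiableAt_const _)
  have key2 : ∀ i j, partialD i (partialD j (fun z => f z + c * g z)) x =
      partialD i (partialD j f) x + c * partialD i (partialD j g) x := by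
    intro i j
    have he : partialD j (fun z => f z + c * g z) =ᶠ[𝓝 x]
        (partialD j f + fun z => c * partialD j g z) := by
      filter_upwards [hd hf, hd hg] with z h1 h2
      exact key z h1 h2 j
    have := ((hp hf j).hasFDerivAt.add ((hp hg j).hasFDerivAt.const_mul c)).fderiv
    unfold partialD at he this ⊢
    rw [he.fderiv_eq, this]
    simp
  unfold ellipticOp
  simp only [key2, key x (hd hf).self_of_nhds (hd hg).self_of_nhds, mul_add,
    Finset.sum_add_distrib, Finset.mul_sum, mul_neg]
  have h1 : ∀ i j, A x i j * (c * partialD i (partialD j g) x) =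
      c * (A x i j * partialD i (partialD j g) x) := fun i j => by ring
  have h2 : ∀ i, b x i * (c * partialD i g x) = c * (b x i * partialD i g x) :=
    fun i => by ring
  simp only [h1, h2]
  ring

/-- Second order necessary condition for a local maximum. -/
theorem IsLocalMax.fderiv_fderiv_nonpos {E : Type*} [NormedAddCommGroup E] [NormedSpace ℝ E]
    {f : E → ℝ} {x : E} (hf : ContDiffAt ℝ 2 f x) (hmax : IsLocalMax f x) (ξ : E) :
    fderiv ℝ (fderiv ℝ f) x ξ ξ ≤ 0 := by
  have hline : ∀ t : ℝ, HasDerivAt (fun t : ℝ => x + t • ξ) ξ t := fun t => by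
    simpa using ((hasDerivAt_id t).smul_const ξ).const_add x
  have hcont : Tendsto (fun t : ℝ => x + t • ξ) (𝓝 0) (𝓝 x) := by
    simpa using (hline 0).continuousAt.tendsto
  set g : ℝ → ℝ := fun t => f (x + t • ξ) with hg
  have hd : deriv g =ᶠ[𝓝 0] fun t => fderiv ℝ f (x + t • ξ) ξ := by
    have h1 : ∀ᶠ z in 𝓝 x, DifferentiableAt ℝ f z := by
      filter_upwards [hf.eventually (by simp)] with z hz
      exact hz.differentiableAt (by norm_num)
    filter_upwards [hcont.eventually h1] with t ht
    exact (ht.hasFDerivAt.comp_hasDerivAt t (hline t)).deriv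
  have h2 : DifferentiableAt ℝ (fderiv ℝ f) x :=
    (hf.fderiv_right (m := 1) (by norm_num)).differentiableAt (by norm_num)
  have hdd : deriv (deriv g) 0 = fderiv ℝ (fderiv ℝ f) x ξ ξ := by
    rw [hd.deriv_eq]
    have h3 : HasFDerivAt (fun z => fderiv ℝ f z ξ)
        ((fderiv ℝ (fderiv ℝ f) x).flip ξ) (x + (0 : ℝ) • ξ) := by
      have := h2.hasFDerivAt.clm_apply (hasFDerivAt_const ξ x)
      simpa using this
    exact (h3.comp_hasDerivAt (0 : ℝ) (hline 0)).deriv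
  have hgmax : IsLocalMax g 0 := by
    have : ∀ᶠ t in 𝓝 (0 : ℝ), f (x + t • ξ) ≤ f x := hcont.eventually hmax
    simpa [IsLocalMax, IsMaxFilter, hg] using this
  rw [← hdd]
  by_contra! hpos
  have hgc : ContinuousAt g 0 := by
    have : ContinuousAt f (x + (0 : ℝ) • ξ) := by simpa using hf.continuousAt
    exact ContinuousAt.comp (f := fun t : ℝ => x + t • ξ) this (hline 0).continuousAt
  -- A positive second derivative would make 0 a local minimum as well as a local maximum, so `g`
  -- would be locally constant and its second derivative zero.
  have hmin := isLocalMin_of_deriv_deriv_pos hpos hgmax.deriv_eq_zero hgc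
  have hconst : g =ᶠ[𝓝 0] fun _ => g 0 := by
    filter_upwards [hgmax, hmin] with t h3 h4
    exact le_antisymm h3 h4
  have h5 : deriv g =ᶠ[𝓝 0] fun _ => 0 := by
    simpa using hconst.deriv
  rw [h5.deriv_eq] at hpos
  simp at hpos

open scoped MatrixOrder Matrix.Norms.L2Operator in
-- Factoring `A = BᵀB` turns the second-order part into a sum of second derivatives of `f` along the
-- rows of `B`, each nonpositive at a local maximum, while the gradient vanishes there.
theorem ellipticOp_nonneg_of_isLocalMax {n : ℕ}
    {A : EuclideanSpace ℝ (Fin n) → Matrix (Fin n) (Fin n) ℝ}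
    {b : EuclideanSpace ℝ (Fin n) → EuclideanSpace ℝ (Fin n)}
    {f : EuclideanSpace ℝ (Fin n) → ℝ} {x : EuclideanSpace ℝ (Fin n)}
    (hA : (A x).PosSemidef) (hf : ContDiffAt ℝ 2 f x) (hmax : IsLocalMax f x) :
    0 ≤ ellipticOp A b f x := by
  obtain ⟨B, hB⟩ := CStarAlgebra.nonneg_iff_eq_star_mul_self.mp hA.nonneg
  have hgrad : ∀ i, partialD i f x = 0 := fun i => by
    simp [partialD, hmax.fderiv_eq_zero]
  have hsum : ∑ i, ∑ j, A x i j * partialD i (partialD j f) x =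
      ∑ k, fderiv ℝ (fderiv ℝ f) x (∑ i, B k i • EuclideanSpace.single i (1 : ℝ))
        (∑ j, B k j • EuclideanSpace.single j (1 : ℝ)) := by
    simp only [partialD_partialD_eq hf, hB, Matrix.star_eq_conjTranspose, Matrix.mul_apply,
      Matrix.conjTranspose_apply, star_trivial, map_sum, map_smul, _root_.sum_apply,
      _root_.smul_apply, smul_eq_mul, Finset.sum_mul, Finset.mul_sum]
    rw [Finset.sum_congr rfl fun i _ => Finset.sum_comm, Finset.sum_comm]
    refine Finset.sum_congr rfl fun k _ => ?_
    rw [Finset.sum_comm]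
    refine Finset.sum_congr rfl fun i _ => Finset.sum_congr rfl fun j _ => ?_
    ring
  unfold ellipticOp
  rw [hsum]
  simp only [hgrad, mul_zero, Finset.sum_const_zero, add_zero, Left.nonneg_neg_iff]
  exact Finset.sum_nonpos fun k _ => hmax.fderiv_fderiv_nonpos hf _

theorem EllipticOn.posSemidef {n : ℕ}
    {A : EuclideanSpace ℝ (Fin n) → Matrix (Fin n) (Fin n) ℝ}
    {Ω : Set (EuclideanSpace ℝ (Fin n))} {c₀ M₁ : ℝ} (hA : EllipticOn A Ω c₀ M₁)
    {x : EuclideanSpace ℝ (Fin n)} (hx : x ∈ Ω) : (A x).PosSemidef := by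
  refine Matrix.PosSemidef.of_dotProduct_mulVec_nonneg ?_ fun ξ => ?_
  · simpa [Matrix.IsHermitian, Matrix.IsSymm] using hA.symm x hx
  · have h := hA.lower x hx (WithLp.toLp 2 ξ)
    have h0 : 0 ≤ c₀ * ‖WithLp.toLp 2 ξ‖ ^ 2 := mul_nonneg hA.c_pos.le (sq_nonneg _)
    refine (h0.trans h).trans_eq ?_
    simp [dotProduct, Matrix.mulVec, Finset.mul_sum, mul_assoc]

/-- Weak maximum principle for strict subsolutions. -/
theorem le_of_ellipticOp_neg {n : ℕ}
    {A : EuclideanSpace ℝ (Fin n) → Matrix (Fin n) (Fin n) ℝ}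
    {b : EuclideanSpace ℝ (Fin n) → EuclideanSpace ℝ (Fin n)}
    {Ω : Set (EuclideanSpace ℝ (Fin n))} {f : EuclideanSpace ℝ (Fin n) → ℝ} {M : ℝ}
    (hΩ : IsOpen Ω) (hcpt : IsCompact (closure Ω)) (hA : ∀ x ∈ Ω, (A x).PosSemidef)
    (hf : ContDiffOn ℝ 2 f Ω) (hfc : ContinuousOn f (closure Ω))
    (hop : ∀ x ∈ Ω, ellipticOp A b f x < 0) (hbd : ∀ x ∈ closure Ω, x ∉ Ω → f x ≤ M)
    {x : EuclideanSpace ℝ (Fin n)} (hx : x ∈ closure Ω) : f x ≤ M := by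
  obtain ⟨z, hz, hzmax⟩ := hcpt.exists_isMaxOn ⟨x, hx⟩ hfc
  refine (hzmax hx).trans (hbd z hz fun hzΩ => ?_)
  have hnhds := hΩ.mem_nhds hzΩ
  exact absurd (ellipticOp_nonneg_of_isLocalMax (b := b) (hA z hzΩ) (hf.contDiffAt hnhds)
    (hzmax.isLocalMax (mem_of_superset hnhds subset_closure))) (hop z hzΩ).not_ge

/-! ### The barrier: negative powers of the distance to a pole -/

theorem partialD_rpow_norm_sq {n : ℕ} {x y : EuclideanSpace ℝ (Fin n)} (hxy : x ≠ y) (p : ℝ)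
    (i : Fin n) : partialD i (fun z => (‖z - y‖ ^ 2) ^ p) x =
      2 * p * (‖x - y‖ ^ 2) ^ (p - 1) * (x i - y i) := by
  have hq : HasFDerivAt (fun z => ‖z - y‖ ^ 2) (2 • innerSL ℝ (x - y)) x := by
    simpa using ((hasFDerivAt_id x).sub_const y).norm_sq
  have hne : ‖x - y‖ ^ 2 ≠ 0 := by simpa [sub_eq_zero] using hxy
  have h := (hq.rpow_const (p := p) (Or.inl hne)).fderiv
  unfold partialD
  rw [h]
  simp [EuclideanSpace.inner_single_right]
  ring

theorem partialD_partialD_rpow_norm_sq {n : ℕ} {x y : EuclideanSpace ℝ (Fin n)} (hxy : x ≠ y)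
    (p : ℝ) (i j : Fin n) : partialD i (partialD j (fun z => (‖z - y‖ ^ 2) ^ p)) x =
      4 * p * (p - 1) * (‖x - y‖ ^ 2) ^ (p - 2) * (x i - y i) * (x j - y j) +
        2 * p * (‖x - y‖ ^ 2) ^ (p - 1) * (if i = j then 1 else 0) := by
  have he : partialD j (fun z => (‖z - y‖ ^ 2) ^ p) =ᶠ[𝓝 x]
      fun z => 2 * p * (‖z - y‖ ^ 2) ^ (p - 1) * (z j - y j) := by
    filter_upwards [isOpen_ne.mem_nhds hxy] with z hz
    exact partialD_rpow_norm_sq hz p j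
  have hq : HasFDerivAt (fun z => ‖z - y‖ ^ 2) (2 • innerSL ℝ (x - y)) x := by
    simpa using ((hasFDerivAt_id x).sub_const y).norm_sq
  have hne : ‖x - y‖ ^ 2 ≠ 0 := by simpa [sub_eq_zero] using hxy
  have hc : HasFDerivAt (fun z : EuclideanSpace ℝ (Fin n) => z j - y j)
      (EuclideanSpace.proj j : EuclideanSpace ℝ (Fin n) →L[ℝ] ℝ) x :=
    (EuclideanSpace.proj j : EuclideanSpace ℝ (Fin n) →L[ℝ] ℝ).hasFDerivAt.sub_const _
  have h := (((hq.rpow_const (p := p - 1) (Or.inl hne)).const_mul (2 * p)).mul hc).fderiv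
  unfold partialD at he ⊢
  rw [he.fderiv_eq]
  change fderiv ℝ ((fun z => 2 * p * (‖z - y‖ ^ 2) ^ (p - 1)) * fun z => z j - y j) x _ = _
  rw [h]
  have h2 : p - 1 - 1 = p - 2 := by ring
  simp [EuclideanSpace.inner_single_right, h2, eq_comm]
  split_ifs <;> ring

theorem contDiffAt_rpow_norm_sq {n : ℕ} {x y : EuclideanSpace ℝ (Fin n)} (hxy : x ≠ y) (p : ℝ) :
    ContDiffAt ℝ 2 (fun z => (‖z - y‖ ^ 2) ^ p) x := by
  have hne : ‖x - y‖ ^ 2 ≠ 0 := by simpa [sub_eq_zero] using hxy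
  exact ContDiffAt.rpow_const_of_ne ((contDiffAt_id.sub contDiffAt_const).norm_sq ℝ) hne

/-- A negative power of the distance to a point is a strict subsolution when the exponent is
large. -/
theorem ellipticOp_rpow_norm_sq_neg {n : ℕ}
    {A : EuclideanSpace ℝ (Fin n) → Matrix (Fin n) (Fin n) ℝ}
    {b : EuclideanSpace ℝ (Fin n) → EuclideanSpace ℝ (Fin n)}
    {Ω : Set (EuclideanSpace ℝ (Fin n))} {c₀ M₁ M₂ s : ℝ}
    (hA : EllipticOn A Ω c₀ M₁) (hb : DriftBoundedOn b Ω M₂)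
    {x y : EuclideanSpace ℝ (Fin n)} (hx : x ∈ Ω) (hxy : x ≠ y) (hs : 0 < s)
    (hlarge : M₁ + M₂ * ‖x - y‖ < (s + 2) * c₀) :
    ellipticOp A b (fun z => (‖z - y‖ ^ 2) ^ (-s / 2)) x < 0 := by
  have hpos : 0 < ‖x - y‖ ^ 2 := by
    have : 0 < ‖x - y‖ := norm_pos_iff.mpr (sub_ne_zero.mpr hxy)
    positivity
  set q := ‖x - y‖ ^ 2 with hq
  set p := -s / 2 with hp
  have hqp : q ^ (p - 1) = q ^ (p - 2) * q := by
    rw [← Real.rpow_add_one hpos.ne']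
    congr 1
    ring
  have hquad : c₀ * q ≤ ∑ i, ∑ j, (x i - y i) * A x i j * (x j - y j) := by
    simpa using hA.lower x hx (x - y)
  have hdrift : -(M₂ * ‖x - y‖) ≤ ∑ i, b x i * (x i - y i) := by
    have h1 : inner ℝ (x - y) (b x) = ∑ i, b x i * (x i - y i) := by
      simp [PiLp.inner_apply]
    rw [← h1]
    have h2 := abs_real_inner_le_norm (x - y) (b x)
    have h3 : ‖x - y‖ * ‖b x‖ ≤ M₂ * ‖x - y‖ := by
      rw [mul_comm]
      exact mul_le_mul_of_nonneg_right (hb.norm_le x hx) (norm_nonneg _)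
    linarith [neg_abs_le (inner ℝ (x - y) (b x))]
  have htr := hA.trace_le x hx
  -- With `p = -s/2`, the coefficient `4p(p - 1)` equals `s(s + 2)` and `2p` equals `-s`; factoring
  -- out `-s q^(p - 2)` leaves a bracket that is at least `q ((s + 2) c₀ - M₁ - M₂ |x - y|)`.
  have hval : ellipticOp A b (fun z => (‖z - y‖ ^ 2) ^ p) x =
      -(s * q ^ (p - 2)) * ((s + 2) * (∑ i, ∑ j, (x i - y i) * A x i j * (x j - y j))
        - q * (A x).trace + q * ∑ i, b x i * (x i - y i)) := by
    unfold ellipticOp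
    simp only [partialD_partialD_rpow_norm_sq hxy, partialD_rpow_norm_sq hxy, ← hq]
    have h1 : ∑ i, ∑ j, A x i j * (4 * p * (p - 1) * q ^ (p - 2) * (x i - y i) * (x j - y j) +
        2 * p * q ^ (p - 1) * (if i = j then 1 else 0)) =
        4 * p * (p - 1) * q ^ (p - 2) * (∑ i, ∑ j, (x i - y i) * A x i j * (x j - y j)) +
          2 * p * q ^ (p - 1) * (A x).trace := by
      simp only [mul_add, Finset.sum_add_distrib, Matrix.trace, Matrix.diag, Finset.mul_sum]
      congr 1
      · refine Finset.sum_congr rfl fun i _ => Finset.sum_congr rfl fun j _ => ?_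
        ring
      · refine Finset.sum_congr rfl fun i _ => ?_
        simp [mul_comm]
    have h2 : ∑ i, b x i * (2 * p * q ^ (p - 1) * (x i - y i)) =
        2 * p * q ^ (p - 1) * ∑ i, b x i * (x i - y i) := by
      rw [Finset.mul_sum]
      refine Finset.sum_congr rfl fun i _ => ?_
      ring
    rw [h1, h2, hqp, hp]
    ring
  rw [hval]
  have hcoef : 0 < s * q ^ (p - 2) := mul_pos hs (Real.rpow_pos_of_pos hpos _)
  refine mul_neg_of_neg_of_pos (neg_lt_zero.mpr hcoef) ?_
  have e1 := mul_le_mul_of_nonneg_left hquad (by linarith : (0 : ℝ) ≤ s + 2)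
  have e2 := mul_le_mul_of_nonneg_left htr hpos.le
  have e3 := mul_le_mul_of_nonneg_left hdrift hpos.le
  have e4 := mul_lt_mul_of_pos_left hlarge hpos
  nlinarith

/-- Normalises the barrier to equal 1 at distance `d` from the pole. -/
theorem rpow_mul_rpow_norm_sq {d t s : ℝ} (hd : 0 < d) (ht : 0 < t) :
    d ^ s * (t ^ 2) ^ (-s / 2) = (d / t) ^ s := by
  have h : (t ^ 2) ^ (-s / 2) = t ^ (-s) := by
    rw [← Real.rpow_natCast, ← Real.rpow_mul ht.le]
    congr 1
    push_cast
    ring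
  rw [h, Real.div_rpow hd.le ht.le, Real.rpow_neg ht.le]
  rfl

/-! ### Geometry and topology of the spiral domain -/

/-- Along successive turns `r₁ (θ + 2πk) < r₂ (θ + 2πk) < r₁ (θ + 2π(k - 1))` for `k ≥ 1`, so the
radii decrease in `k` to their limit `rs`. -/
theorem SpiralCurves.le_fst {θ₀ rs : ℝ} {r₁ r₂ : ℝ → ℝ} (h : SpiralCurves θ₀ rs r₁ r₂)
    {θ : ℝ} (hθ : θ₀ ≤ θ) : rs ≤ r₁ θ := by
  have hk : ∀ k : ℕ, θ₀ ≤ θ + k * (2 * Real.pi) := fun k => by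
    have : 0 ≤ (k : ℝ) * (2 * Real.pi) := by positivity
    linarith
  have hanti : Antitone fun k : ℕ => r₁ (θ + k * (2 * Real.pi)) := by
    refine antitone_nat_of_succ_le fun k => ?_
    have h1 := h.next_lt _ (hk k)
    have h2 := h.lt _ (hk (k + 1))
    have h3 : θ + ((k + 1 : ℕ) : ℝ) * (2 * Real.pi) =
        θ + (k : ℝ) * (2 * Real.pi) + 2 * Real.pi := by
      push_cast
      ring
    rw [h3] at h2 ⊢
    linarith
  have hlim : Tendsto (fun k : ℕ => r₁ (θ + k * (2 * Real.pi))) atTop (𝓝 rs) := by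
    refine h.tendsto₁.comp (tendsto_atTop_add_const_left _ _ ?_)
    exact tendsto_natCast_atTop_atTop.atTop_mul_const (by positivity)
  simpa using hanti.le_of_tendsto hlim 0

theorem norm_sq_polarX_sub (r θ ρ φ : ℝ) :
    ‖polarX r θ - polarX ρ φ‖ ^ 2 = r ^ 2 + ρ ^ 2 - 2 * r * ρ * Real.cos (θ - φ) := by
  rw [EuclideanSpace.norm_sq_eq]
  simp only [polarX, Fin.sum_univ_two, PiLp.sub_apply, Real.norm_eq_abs, sq_abs,
    Real.cos_sub]
  simp
  linear_combination r ^ 2 * Real.sin_sq_add_cos_sq θ + ρ ^ 2 * Real.sin_sq_add_cos_sq φ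

theorem continuous_polarX : Continuous fun p : ℝ × ℝ => polarX p.1 p.2 := by
  unfold polarX
  refine (PiLp.continuous_toLp 2 _).comp (continuous_pi fun i => ?_)
  fin_cases i <;> simp <;> fun_prop

/-- Rotating by `-φ` moves the angles into `(-π, π)`, where the polar chart is an open map; `T` is
the rotation back by `φ`. -/
theorem isOpen_image_polarX {W : Set (ℝ × ℝ)} (hW : IsOpen W) {φ : ℝ}
    (hsub : ∀ p ∈ W, 0 < p.1 ∧ p.2 ∈ Ioo (φ - Real.pi) (φ + Real.pi)) :
    IsOpen ((fun p : ℝ × ℝ => polarX p.1 p.2) '' W) := by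
  let T : ℝ × ℝ ≃ₜ EuclideanSpace ℝ (Fin 2) :=
    { toFun := fun p => !₂[p.1 * Real.cos φ - p.2 * Real.sin φ,
        p.1 * Real.sin φ + p.2 * Real.cos φ]
      invFun := fun x => (x 0 * Real.cos φ + x 1 * Real.sin φ,
        -(x 0 * Real.sin φ) + x 1 * Real.cos φ)
      left_inv := fun p => by
        have h := Real.sin_sq_add_cos_sq φ
        ext
        · simp
          linear_combination p.1 * h
        · simp
          linear_combination p.2 * h
      right_inv := fun x => by
        have h := Real.sin_sq_add_cos_sq φ
        ext i
        fin_cases i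
        · simp
          linear_combination x 0 * h
        · simp
          linear_combination x 1 * h
      continuous_toFun := by
        refine (PiLp.continuous_toLp 2 _).comp (continuous_pi fun i => ?_)
        fin_cases i <;> simp <;> fun_prop
      continuous_invFun := by fun_prop }
  have hV : IsOpen ((fun p : ℝ × ℝ => (p.1, p.2 + φ)) ⁻¹' W) := hW.preimage (by fun_prop)
  have hVt : (fun p : ℝ × ℝ => (p.1, p.2 + φ)) ⁻¹' W ⊆ polarCoord.target := by
    intro p hp
    obtain ⟨h1, h2, h3⟩ := hsub _ hp
    rw [polarCoord_target]
    simp only at h1 h2 h3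
    exact ⟨h1, by linarith, by linarith⟩
  have hopen := T.isOpenMap _ (polarCoord.isOpen_image_symm_of_subset_target hV hVt)
  convert hopen using 1
  rw [← image_comp]
  ext x
  have hT : ∀ r θ, T (polarCoord.symm (r, θ)) = polarX r (θ + φ) := fun r θ => by
    change !₂[_, _] = _
    ext i
    fin_cases i <;> simp [polarX, polarCoord, Real.cos_add, Real.sin_add] <;> ring
  constructor
  · rintro ⟨⟨r, θ⟩, hp, rfl⟩
    exact ⟨(r, θ - φ), by simpa using hp, (hT r (θ - φ)).trans (by rw [sub_add_cancel])⟩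
  · rintro ⟨⟨r, θ⟩, hp, rfl⟩
    exact ⟨(r, θ + φ), hp, (hT r θ).symm⟩

theorem isOpen_spiralPiece {r₁ r₂ : ℝ → ℝ} {φ a c : ℝ} (hr₁ : ContinuousOn r₁ (Ioo a c))
    (hr₂ : ContinuousOn r₂ (Ioo a c)) (hpos : ∀ θ ∈ Ioo a c, 0 < r₁ θ)
    (ha : φ - Real.pi ≤ a) (hc : c ≤ φ + Real.pi) :
    IsOpen (spiralPiece r₁ r₂ (Ioo a c)) := by
  have h0 : IsOpen ((univ : Set ℝ) ×ˢ Ioo a c) := isOpen_univ.prod isOpen_Ioo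
  have hm : MapsTo (Prod.snd : ℝ × ℝ → ℝ) ((univ : Set ℝ) ×ˢ Ioo a c) (Ioo a c) :=
    fun p hp => hp.2
  have g₁ : ContinuousOn (fun p : ℝ × ℝ => p.1 - r₁ p.2) ((univ : Set ℝ) ×ˢ Ioo a c) :=
    continuousOn_fst.sub (hr₁.comp continuousOn_snd hm)
  have g₂ : ContinuousOn (fun p : ℝ × ℝ => r₂ p.2 - p.1) ((univ : Set ℝ) ×ˢ Ioo a c) :=
    (hr₂.comp continuousOn_snd hm).sub continuousOn_fst
  have hW := (g₁.isOpen_inter_preimage h0 (isOpen_Ioi (a := 0))).inter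
    (g₂.isOpen_inter_preimage h0 (isOpen_Ioi (a := 0)))
  convert isOpen_image_polarX (φ := φ) hW ?_ using 1
  · ext x
    constructor
    · rintro ⟨r, θ, hθ, h1, h2, rfl⟩
      exact ⟨(r, θ), ⟨⟨⟨mem_univ _, hθ⟩, by simpa using h1⟩, ⟨⟨mem_univ _, hθ⟩, by simpa using h2⟩⟩, rfl⟩
    · rintro ⟨⟨r, θ⟩, ⟨⟨⟨-, hθ⟩, h1⟩, ⟨-, h2⟩⟩, rfl⟩
      exact ⟨r, θ, hθ, by simpa using h1, by simpa using h2, rfl⟩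
  · rintro ⟨r, θ⟩ ⟨⟨⟨-, hθ⟩, h1⟩, -⟩
    have h1' : r₁ θ < r := by simpa using h1
    exact ⟨(hpos θ hθ).trans h1', ha.trans_lt hθ.1, hθ.2.trans_le hc⟩

section Closure

variable {r₁ r₂ : ℝ → ℝ} {a c : ℝ}

theorem continuousOn_polarX_convexComb (hr₁ : ContinuousOn r₁ (Icc a c))
    (hr₂ : ContinuousOn r₂ (Icc a c)) :
    ContinuousOn (fun p : ℝ × ℝ => polarX ((1 - p.1) * r₁ p.2 + p.1 * r₂ p.2) p.2)
      (Icc 0 1 ×ˢ Icc a c) := by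
  have hm : MapsTo (Prod.snd : ℝ × ℝ → ℝ) (Icc (0 : ℝ) 1 ×ˢ Icc a c) (Icc a c) := fun p hp => hp.2
  have k₁ := hr₁.comp continuousOn_snd hm
  have k₂ := hr₂.comp continuousOn_snd hm
  refine continuous_polarX.comp_continuousOn
    (ContinuousOn.prodMk (((continuousOn_const.sub continuousOn_fst).mul k₁).add
      (continuousOn_fst.mul k₂)) continuousOn_snd)

/-- Interpolating linearly between the two radii parametrises the piece by a fixed rectangle, from
which compactness and the closure formula follow. -/
theorem spiralPieceClosed_eq_image (hlt : ∀ θ ∈ Icc a c, r₁ θ < r₂ θ) :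
    spiralPieceClosed r₁ r₂ (Icc a c) =
      (fun p : ℝ × ℝ => polarX ((1 - p.1) * r₁ p.2 + p.1 * r₂ p.2) p.2) ''
        (Icc 0 1 ×ˢ Icc a c) := by
  ext x
  constructor
  · rintro ⟨r, θ, hθ, h1, h2, rfl⟩
    have h := sub_pos.mpr (hlt θ hθ)
    refine ⟨((r - r₁ θ) / (r₂ θ - r₁ θ), θ), ⟨⟨div_nonneg (by linarith) h.le, ?_⟩, hθ⟩, ?_⟩
    · exact (div_le_one h).mpr (by linarith)
    · simp only
      congr 1
      field_simp
      ring
  · rintro ⟨⟨t, θ⟩, ⟨⟨h0, h1⟩, hθ⟩, rfl⟩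
    have h := sub_pos.mpr (hlt θ hθ)
    simp only at h0 h1
    exact ⟨_, θ, hθ, by nlinarith, by nlinarith, rfl⟩

theorem isCompact_spiralPieceClosed (hr₁ : ContinuousOn r₁ (Icc a c))
    (hr₂ : ContinuousOn r₂ (Icc a c)) (hlt : ∀ θ ∈ Icc a c, r₁ θ < r₂ θ) :
    IsCompact (spiralPieceClosed r₁ r₂ (Icc a c)) := by
  rw [spiralPieceClosed_eq_image hlt]
  exact (isCompact_Icc.prod isCompact_Icc).image_of_continuousOn
    (continuousOn_polarX_convexComb hr₁ hr₂)

theorem closure_spiralPiece (hac : a < c) (hr₁ : ContinuousOn r₁ (Icc a c))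
    (hr₂ : ContinuousOn r₂ (Icc a c)) (hlt : ∀ θ ∈ Icc a c, r₁ θ < r₂ θ) :
    closure (spiralPiece r₁ r₂ (Ioo a c)) = spiralPieceClosed r₁ r₂ (Icc a c) := by
  refine subset_antisymm (closure_minimal ?_
    (isCompact_spiralPieceClosed hr₁ hr₂ hlt).isClosed) ?_
  · rintro x ⟨r, θ, hθ, h1, h2, rfl⟩
    exact ⟨r, θ, Ioo_subset_Icc_self hθ, h1.le, h2.le, rfl⟩
  · have hcl : closure (Ioo (0 : ℝ) 1 ×ˢ Ioo a c) = Icc 0 1 ×ˢ Icc a c := by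
      rw [closure_prod_eq, closure_Ioo (by norm_num), closure_Ioo hac.ne]
    have hcont := continuousOn_polarX_convexComb hr₁ hr₂
    rw [spiralPieceClosed_eq_image hlt, ← hcl]
    rw [← hcl] at hcont
    refine hcont.image_closure.trans (closure_mono ?_)
    rintro x ⟨⟨t, θ⟩, ⟨⟨h0, h1⟩, hθ⟩, rfl⟩
    have h := sub_pos.mpr (hlt θ (Ioo_subset_Icc_self hθ))
    simp only at h0 h1
    exact ⟨_, θ, hθ, by nlinarith, by nlinarith, rfl⟩

end Closure

theorem isCompact_crossSection (r₁ r₂ : ℝ → ℝ) (θ : ℝ) : IsCompact (crossSection r₁ r₂ θ) := by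
  have h : crossSection r₁ r₂ θ = (fun r => polarX r θ) '' Icc (r₁ θ) (r₂ θ) := by
    ext x
    constructor
    · rintro ⟨r, h1, h2, rfl⟩
      exact ⟨r, ⟨h1, h2⟩, rfl⟩
    · rintro ⟨r, ⟨h1, h2⟩, rfl⟩
      exact ⟨r, h1, h2, rfl⟩
  rw [h]
  exact isCompact_Icc.image
    (continuous_polarX.comp (Continuous.prodMk continuous_id continuous_const))

theorem crossSection_subset {r₁ r₂ : ℝ → ℝ} {I : Set ℝ} {θ : ℝ} (hθ : θ ∈ I) :
    crossSection r₁ r₂ θ ⊆ spiralPieceClosed r₁ r₂ I := by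
  rintro x ⟨r, h1, h2, rfl⟩
  exact ⟨r, θ, hθ, h1, h2, rfl⟩

theorem exists_isMaxPosPart {E : Type*} [TopologicalSpace E] {u : E → ℝ} {S : Set E}
    (hS : IsCompact S) (hne : S.Nonempty) (hu : ContinuousOn u S) :
    ∃ m, IsMaxPosPart u S m :=
  (hS.image_of_continuousOn (continuousOn_const.sup hu)).exists_isGreatest (hne.image _)

/-! ### The constant `η` and its dependence on `d` and `s` -/

section EtaStar

variable {rs d₀ θs d : ℝ}

theorem sub_pos_of_cos_lt (hrs : 0 < rs) (hd₀ : 0 < d₀) (hcos : Real.cos θs < rs / (rs + d₀)) :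
    0 < (rs + d₀) * (1 - Real.cos θs) - d₀ := by
  have := (lt_div_iff₀ (by linarith)).mp hcos
  linarith

/-- The terms `d ^ 2` cancel, leaving an inequality linear in `d`. The left side compares the
squares of `d + d₀` and `d̂`, which decides whether `η ≤ 1`. -/
theorem sq_add_le_iff (hpos : 0 < (rs + d₀) * (1 - Real.cos θs) - d₀) :
    (d + d₀) ^ 2 ≤ d ^ 2 + 2 * d * (rs + d₀) * (1 - Real.cos θs) ↔
      d₀ ^ 2 / (2 * ((rs + d₀) * (1 - Real.cos θs) - d₀)) ≤ d := by
  rw [div_le_iff₀ (by linarith)]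
  constructor <;> intro h <;> linarith

theorem sq_add_lt_iff (hpos : 0 < (rs + d₀) * (1 - Real.cos θs) - d₀) :
    (d + d₀) ^ 2 < d ^ 2 + 2 * d * (rs + d₀) * (1 - Real.cos θs) ↔
      d₀ ^ 2 / (2 * ((rs + d₀) * (1 - Real.cos θs) - d₀)) < d := by
  rw [div_lt_iff₀ (by linarith)]
  constructor <;> intro h <;> linarith

theorem dHat_pos (hR : 0 < rs + d₀) (hd : 0 < d) : 0 < dHat rs d₀ θs d := by
  have h1 := Real.cos_le_one θs
  have : 0 ≤ 2 * d * (rs + d₀) * (1 - Real.cos θs) :=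
    mul_nonneg (by positivity) (by linarith)
  exact Real.sqrt_pos.mpr (by positivity)

theorem etaStar_pos (hd₀ : 0 < d₀) (hR : 0 < rs + d₀) (hd : 0 < d) {s : ℝ} (hs : 0 < s) :
    0 < etaStar rs d₀ θs d s := by
  have h1 : (d / (d + d₀)) ^ s < 1 :=
    Real.rpow_lt_one (by positivity) ((div_lt_one (by linarith)).mpr (by linarith)) hs
  have h2 : 0 ≤ (d / dHat rs d₀ θs d) ^ s :=
    Real.rpow_nonneg (div_nonneg hd.le (dHat_pos hR hd).le) s
  unfold etaStar
  linarith

theorem etaStar_le_one (hd₀ : 0 < d₀) (hpos : 0 < (rs + d₀) * (1 - Real.cos θs) - d₀)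
    (hd : 0 < d) (hle : d₀ ^ 2 / (2 * ((rs + d₀) * (1 - Real.cos θs) - d₀)) ≤ d)
    {s : ℝ} (hs : 0 < s) : etaStar rs d₀ θs d s ≤ 1 := by
  have h1 : d + d₀ ≤ dHat rs d₀ θs d := Real.le_sqrt_of_sq_le ((sq_add_le_iff hpos).mpr hle)
  have h2 : (d / dHat rs d₀ θs d) ^ s ≤ (d / (d + d₀)) ^ s :=
    Real.rpow_le_rpow (div_nonneg hd.le (by linarith))
      (div_le_div_of_nonneg_left hd.le (by linarith) h1) hs.le
  unfold etaStar
  linarith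

theorem etaStar_lt_one (hd₀ : 0 < d₀) (hpos : 0 < (rs + d₀) * (1 - Real.cos θs) - d₀)
    (hd : 0 < d) (hlt : d₀ ^ 2 / (2 * ((rs + d₀) * (1 - Real.cos θs) - d₀)) < d)
    {s : ℝ} (hs : 0 < s) : etaStar rs d₀ θs d s < 1 := by
  have h1 : d + d₀ < dHat rs d₀ θs d := Real.lt_sqrt_of_sq_lt ((sq_add_lt_iff hpos).mpr hlt)
  have h2 : (d / dHat rs d₀ θs d) ^ s < (d / (d + d₀)) ^ s :=
    Real.rpow_lt_rpow (div_nonneg hd.le (by linarith))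
      (div_lt_div_of_pos_left hd (by linarith) h1) hs
  unfold etaStar
  linarith

theorem continuous_etaStar (hd₀ : 0 < d₀) (hR : 0 < rs + d₀) (hd : 0 < d) :
    Continuous (etaStar rs d₀ θs d) := by
  have h1 : d / (d + d₀) ≠ 0 := by positivity
  have h2 : d / dHat rs d₀ θs d ≠ 0 := div_ne_zero hd.ne' (dHat_pos hR hd).ne'
  unfold etaStar
  exact continuous_const.sub ((Real.continuous_const_rpow h1).sub (Real.continuous_const_rpow h2))

end EtaStar

/-! ### Distances to the pole, from the law of cosines -/

section Distance

variable {r R d k c : ℝ}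

/-- At `k = 1` the right side is `(R + d - r) ^ 2`, and lowering `k` only increases it. -/
theorem sq_le_dist_sq (hr : 0 ≤ r) (hrR : r ≤ R) (hd : 0 ≤ d) (hk : k ≤ 1) :
    d ^ 2 ≤ r ^ 2 + (R + d) ^ 2 - 2 * r * (R + d) * k := by
  have h1 : 0 ≤ 2 * r * (R + d) * (1 - k) :=
    mul_nonneg (mul_nonneg (by linarith) (by linarith)) (by linarith)
  nlinarith

/-- The claim amounts to `r ≤ 2 (R + d) k` after factoring out `r`, and already `r ≤ R ≤ (R + d) k`.
-/
theorem dist_sq_le_sq (hr : 0 ≤ r) (hrR : r ≤ R) (hd : 0 ≤ d) (hc : R ≤ (R + d) * c)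
    (hk : c ≤ k) : r ^ 2 + (R + d) ^ 2 - 2 * r * (R + d) * k ≤ (R + d) ^ 2 := by
  have h1 : (R + d) * c ≤ (R + d) * k := mul_le_mul_of_nonneg_left hk (by linarith)
  nlinarith

/-- As a quadratic in `r` the right side decreases up to `(R + d) c`, hence on `r ≤ R`. Its value at
`r = R` is the left side plus `2 R ^ 2 (1 - c)`, which is discarded. The product in `h1` is the
difference of the values at `r` and `R`. -/
theorem le_dist_sq_of_angle (hrR : r ≤ R) (hc : R ≤ (R + d) * c) (hc1 : c ≤ 1) :
    d ^ 2 + 2 * d * R * (1 - c) ≤ r ^ 2 + (R + d) ^ 2 - 2 * r * (R + d) * c := by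
  have h1 : 0 ≤ (R - r) * (2 * ((R + d) * c) - R - r) :=
    mul_nonneg (by linarith) (by linarith)
  have h2 : 0 ≤ 2 * R ^ 2 * (1 - c) := mul_nonneg (by positivity) (by linarith)
  nlinarith

end Distance

/-! ### Comparison with the barrier and the growth inequality -/

section Growth

variable {θ₀ rs : ℝ} {r₁ r₂ : ℝ → ℝ} {θb d₀ θs : ℝ}

theorem SpiralCurves.bounds (hcurves : SpiralCurves θ₀ rs r₁ r₂) (hθb : θ₀ ≤ θb)
    (hinside : ∀ θ ∈ Icc θb (θb + 2 * θs), r₂ θ ≤ rs + d₀) {θ r : ℝ}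
    (hθ : θ ∈ Icc θb (θb + 2 * θs)) (h1 : r₁ θ ≤ r) (h2 : r ≤ r₂ θ) :
    rs ≤ r ∧ r ≤ rs + d₀ :=
  ⟨(hcurves.le_fst (hθb.trans hθ.1)).trans h1, h2.trans (hinside θ hθ)⟩

theorem cos_le_cos_sub_mid (hθs : θs ∈ Ioo 0 (Real.pi / 2)) {θ : ℝ}
    (hθ : θ ∈ Icc θb (θb + 2 * θs)) : Real.cos θs ≤ Real.cos (θ - (θb + θs)) := by
  rw [← Real.cos_abs (θ - (θb + θs))]
  refine Real.cos_le_cos_of_nonneg_of_le_pi (abs_nonneg _) ?_ ?_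
  · linarith [hθs.2, Real.pi_pos]
  · rw [abs_le]
    constructor <;> linarith [hθ.1, hθ.2]

theorem mem_boundary_of_notMem_spiralPiece (hθb : θ₀ ≤ θb)
    {x : EuclideanSpace ℝ (Fin 2)}
    (hx : x ∈ spiralPieceClosed r₁ r₂ (Icc θb (θb + 2 * θs)))
    (hxΩ : x ∉ spiralPiece r₁ r₂ (Ioo θb (θb + 2 * θs))) :
    x ∈ spiralBoundary θ₀ r₁ r₂ ∩ spiralPieceClosed r₁ r₂ (Icc θb (θb + 2 * θs)) ∨
      x ∈ crossSection r₁ r₂ θb ∨ x ∈ crossSection r₁ r₂ (θb + 2 * θs) := by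
  obtain ⟨r, θ, hθ, h1, h2, rfl⟩ := id hx
  rcases hθ.1.eq_or_lt with rfl | ha
  · exact Or.inr (Or.inl ⟨r, h1, h2, rfl⟩)
  rcases hθ.2.eq_or_lt with rfl | hc
  · exact Or.inr (Or.inr ⟨r, h1, h2, rfl⟩)
  rcases h1.eq_or_lt with rfl | h1'
  · exact Or.inl ⟨Or.inl ⟨θ, hθb.trans hθ.1, rfl⟩, hx⟩
  rcases h2.eq_or_lt with rfl | h2'
  · exact Or.inl ⟨Or.inr ⟨θ, hθb.trans hθ.1, rfl⟩, hx⟩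
  exact absurd ⟨r, θ, ⟨ha, hc⟩, h1', h2', rfl⟩ hxΩ

variable {A : EuclideanSpace ℝ (Fin 2) → Matrix (Fin 2) (Fin 2) ℝ}
  {b : EuclideanSpace ℝ (Fin 2) → EuclideanSpace ℝ (Fin 2)} {c₀ M₁ M₂ d s m : ℝ}
  {u : EuclideanSpace ℝ (Fin 2) → ℝ}

/-- The barrier argument itself. Strict `hlarge` and `m > 0` make `u` plus the barrier a strict
subsolution, as the maximum principle requires. -/
theorem le_etaStar_mul_of_strict (hcurves : SpiralCurves θ₀ rs r₁ r₂)
    (hθb : θ₀ ≤ θb) (hd₀ : 0 < d₀) (hθs : θs ∈ Ioo 0 (Real.pi / 2))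
    (hinside : ∀ θ ∈ Icc θb (θb + 2 * θs), r₂ θ ≤ rs + d₀)
    (hA : EllipticOn A (spiralPiece r₁ r₂ (Ioo θb (θb + 2 * θs))) c₀ M₁)
    (hb : DriftBoundedOn b (spiralPiece r₁ r₂ (Ioo θb (θb + 2 * θs))) M₂)
    (hd : 0 < d) (hdR : rs + d₀ ≤ (rs + d₀ + d) * Real.cos θs)
    (hs : 0 < s) (hlarge : M₁ + M₂ * (rs + d₀ + d) < (s + 2) * c₀)
    (hu : SubsolutionOn A b (spiralPiece r₁ r₂ (Ioo θb (θb + 2 * θs)))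
      (spiralBoundary θ₀ r₁ r₂ ∩ spiralPieceClosed r₁ r₂ (Icc θb (θb + 2 * θs))) u)
    (hm : 0 < m) (hm₀ : ∀ x ∈ crossSection r₁ r₂ θb, u x ≤ m)
    (hm₂ : ∀ x ∈ crossSection r₁ r₂ (θb + 2 * θs), u x ≤ m)
    {x : EuclideanSpace ℝ (Fin 2)} (hx : x ∈ crossSection r₁ r₂ (θb + θs)) :
    u x ≤ etaStar rs d₀ θs d s * m := by
  have hrs := hcurves.radius_pos
  have hR : 0 < rs + d₀ := by linarith
  have hIcc : Icc θb (θb + 2 * θs) ⊆ Ici θ₀ := fun θ hθ => hθb.trans hθ.1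
  have hr₁ := hcurves.cont₁.mono hIcc
  have hr₂ := hcurves.cont₂.mono hIcc
  have hlt : ∀ θ ∈ Icc θb (θb + 2 * θs), r₁ θ < r₂ θ := fun θ hθ => hcurves.lt θ (hIcc hθ)
  have hcl := closure_spiralPiece (by linarith [hθs.1]) hr₁ hr₂ hlt
  -- The angular width `2 θs` is less than `π`, so the piece fits in one polar chart centred at the
  -- middle angle.
  have hopen : IsOpen (spiralPiece r₁ r₂ (Ioo θb (θb + 2 * θs))) :=
    isOpen_spiralPiece (φ := θb + θs) (hr₁.mono Ioo_subset_Icc_self)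
      (hr₂.mono Ioo_subset_Icc_self) (fun θ hθ => hcurves.pos₁ θ (hIcc (Ioo_subset_Icc_self hθ)))
      (by linarith [hθs.2, Real.pi_pos]) (by linarith [hθs.2, Real.pi_pos])
  have hcpt : IsCompact (closure (spiralPiece r₁ r₂ (Ioo θb (θb + 2 * θs)))) := by
    rw [hcl]
    exact isCompact_spiralPieceClosed hr₁ hr₂ hlt
  set Ω := spiralPiece r₁ r₂ (Ioo θb (θb + 2 * θs)) with hΩ
  set y := polarX (rs + d₀ + d) (θb + θs) with hy
  have hDpos := dHat_pos (θs := θs) hR hd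
  have hdist : ∀ z ∈ spiralPieceClosed r₁ r₂ (Icc θb (θb + 2 * θs)),
      d ≤ ‖z - y‖ ∧ ‖z - y‖ ≤ rs + d₀ + d := by
    rintro z ⟨r, θ, hθ, h1, h2, rfl⟩
    obtain ⟨h3, h4⟩ := hcurves.bounds hθb hinside hθ h1 h2
    have hr : 0 ≤ r := hrs.le.trans h3
    constructor
    · refine le_of_sq_le_sq ?_ (norm_nonneg _)
      rw [norm_sq_polarX_sub]
      exact sq_le_dist_sq hr h4 hd.le (Real.cos_le_one _)
    · refine le_of_sq_le_sq ?_ (by linarith)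
      rw [norm_sq_polarX_sub]
      exact dist_sq_le_sq hr h4 hd.le hdR (cos_le_cos_sub_mid hθs hθ)
  have hside : ∀ θ, (θ = θb ∨ θ = θb + 2 * θs) → ∀ z ∈ crossSection r₁ r₂ θ,
      dHat rs d₀ θs d ≤ ‖z - y‖ := by
    rintro θ hθ z ⟨r, h1, h2, rfl⟩
    have hmem : θ ∈ Icc θb (θb + 2 * θs) := by
      rcases hθ with rfl | rfl <;> constructor <;> linarith [hθs.1]
    obtain ⟨h3, h4⟩ := hcurves.bounds hθb hinside hmem h1 h2
    have hcosθ : Real.cos (θ - (θb + θs)) = Real.cos θs := by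
      rcases hθ with rfl | rfl
      · rw [← Real.cos_neg]
        congr 1
        ring
      · congr 1
        ring
    refine (Real.sqrt_le_left (norm_nonneg _)).mpr ?_
    rw [norm_sq_polarX_sub, hcosθ]
    exact le_dist_sq_of_angle h4 hdR (Real.cos_le_one _)
  have hne : ∀ z ∈ spiralPieceClosed r₁ r₂ (Icc θb (θb + 2 * θs)), z ≠ y := fun z hz =>
    sub_ne_zero.mp (norm_pos_iff.mp (hd.trans_le (hdist z hz).1))
  have hsub : Ω ⊆ spiralPieceClosed r₁ r₂ (Icc θb (θb + 2 * θs)) := hcl ▸ subset_closure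
  set v : EuclideanSpace ℝ (Fin 2) → ℝ := fun z => (‖z - y‖ ^ 2) ^ (-s / 2) with hv
  have hcoef : 0 < m * d ^ s := mul_pos hm (Real.rpow_pos_of_pos hd s)
  have hcv : ∀ z ∈ spiralPieceClosed r₁ r₂ (Icc θb (θb + 2 * θs)),
      m * d ^ s * v z = m * (d / ‖z - y‖) ^ s := fun z hz => by
    rw [mul_assoc, hv, rpow_mul_rpow_norm_sq hd (hd.trans_le (hdist z hz).1)]
  have hbarrier : ∀ z ∈ closure Ω,
      u z + m * d ^ s * v z ≤ m * (1 + (d / dHat rs d₀ θs d) ^ s) := by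
    refine fun z hz => le_of_ellipticOp_neg (A := A) (b := b) (Ω := Ω)
      (f := fun z => u z + m * d ^ s * v z) hopen hcpt (fun x hx => hA.posSemidef hx)
      ?_ ?_ ?_ ?_ hz
    · exact hu.contDiff.add (contDiffOn_const.mul fun w hw =>
        (contDiffAt_rpow_norm_sq (hne w (hsub hw)) _).contDiffWithinAt)
    · refine hu.cont.add (continuousOn_const.mul fun w hw => ?_)
      exact (contDiffAt_rpow_norm_sq (hne w (hcl ▸ hw)) _).continuousAt.continuousWithinAt
    · intro w hw
      rw [ellipticOp_add_const_mul A b (hu.contDiff.contDiffAt (hopen.mem_nhds hw))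
        (contDiffAt_rpow_norm_sq (hne w (hsub hw)) _)]
      refine add_neg_of_nonpos_of_neg (hu.op_nonpos w hw) (mul_neg_of_pos_of_neg hcoef
        (ellipticOp_rpow_norm_sq_neg hA hb hw (hne w (hsub hw)) hs ?_))
      -- The drift enters through `M₂ |w - y|`, so the bound `|w - y| ≤ rs + d₀ + d` suffices.
      exact (add_le_add_right (mul_le_mul_of_nonneg_left (hdist w (hsub hw)).2 hb.M_nonneg)
        M₁).trans_lt hlarge
    · intro w hw hwΩ
      rw [hcl] at hw
      rw [hcv w hw, mul_add, mul_one]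
      have hDs : 0 ≤ m * (d / dHat rs d₀ θs d) ^ s :=
        mul_nonneg hm.le (Real.rpow_nonneg (div_nonneg hd.le hDpos.le) s)
      have hside' : dHat rs d₀ θs d ≤ ‖w - y‖ →
          m * (d / ‖w - y‖) ^ s ≤ m * (d / dHat rs d₀ θs d) ^ s := fun h =>
        mul_le_mul_of_nonneg_left (Real.rpow_le_rpow (by positivity)
          (div_le_div_of_nonneg_left hd.le hDpos h) hs.le) hm.le
      rcases mem_boundary_of_notMem_spiralPiece hθb hw hwΩ with h | h | h
      · have h1 := hu.nonpos w h
        have h2 : (d / ‖w - y‖) ^ s ≤ 1 := Real.rpow_le_one (by positivity)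
          ((div_le_one (hd.trans_le (hdist w hw).1)).mpr (hdist w hw).1) hs.le
        have h3 := mul_le_mul_of_nonneg_left h2 hm.le
        linarith
      · linarith [hm₀ w h, hside' (hside θb (Or.inl rfl) w h)]
      · linarith [hm₂ w h, hside' (hside _ (Or.inr rfl) w h)]
  have hmid : θb + θs ∈ Icc θb (θb + 2 * θs) := by constructor <;> linarith [hθs.1]
  have hxcl := crossSection_subset hmid hx
  have hb1 := hbarrier x (by rwa [hcl])
  rw [hcv x hxcl] at hb1
  -- On the middle ray the distance is `rs + d₀ + d - r`, and `r ≥ rs`.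
  have hnear : ‖x - y‖ ≤ d + d₀ := by
    obtain ⟨r, h1, h2, rfl⟩ := hx
    obtain ⟨h3, h4⟩ := hcurves.bounds hθb hinside hmid h1 h2
    refine le_of_sq_le_sq ?_ (by linarith)
    rw [norm_sq_polarX_sub, sub_self, Real.cos_zero]
    nlinarith
  have hb2 : m * (d / (d + d₀)) ^ s ≤ m * (d / ‖x - y‖) ^ s :=
    mul_le_mul_of_nonneg_left (Real.rpow_le_rpow (by positivity)
      (div_le_div_of_nonneg_left hd.le (hd.trans_le (hdist x hxcl).1) hnear) hs.le) hm.le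
  unfold etaStar
  linarith

theorem growthIneq_etaStar (hcurves : SpiralCurves θ₀ rs r₁ r₂)
    (hθb : θ₀ ≤ θb) (hd₀ : 0 < d₀) (hθs : θs ∈ Ioo 0 (Real.pi / 2))
    (hinside : ∀ θ ∈ Icc θb (θb + 2 * θs), r₂ θ ≤ rs + d₀)
    (hA : EllipticOn A (spiralPiece r₁ r₂ (Ioo θb (θb + 2 * θs))) c₀ M₁)
    (hb : DriftBoundedOn b (spiralPiece r₁ r₂ (Ioo θb (θb + 2 * θs))) M₂)
    (hd : 0 < d) (hdR : rs + d₀ ≤ (rs + d₀ + d) * Real.cos θs)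
    (hs : 0 < s) (hlarge : M₁ + M₂ * (rs + d₀ + d) ≤ (s + 2) * c₀)
    (hu : SubsolutionOn A b (spiralPiece r₁ r₂ (Ioo θb (θb + 2 * θs)))
      (spiralBoundary θ₀ r₁ r₂ ∩ spiralPieceClosed r₁ r₂ (Icc θb (θb + 2 * θs))) u) :
    GrowthIneq u (crossSection r₁ r₂ θb) (crossSection r₁ r₂ (θb + θs))
      (crossSection r₁ r₂ (θb + 2 * θs)) (etaStar rs d₀ θs d s) := by
  have hR : 0 < rs + d₀ := by linarith [hcurves.radius_pos]
  have hIcc : Icc θb (θb + 2 * θs) ⊆ Ici θ₀ := fun θ hθ => hθb.trans hθ.1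
  have hcl := closure_spiralPiece (by linarith [hθs.1]) (hcurves.cont₁.mono hIcc)
    (hcurves.cont₂.mono hIcc) fun θ hθ => hcurves.lt θ (hIcc hθ)
  have hmax : ∀ θ ∈ Icc θb (θb + 2 * θs), ∃ m, IsMaxPosPart u (crossSection r₁ r₂ θ) m := by
    intro θ hθ
    refine exists_isMaxPosPart (isCompact_crossSection r₁ r₂ θ)
      ⟨_, r₁ θ, le_rfl, (hcurves.lt θ (hIcc hθ)).le, rfl⟩ (hu.cont.mono ?_)
    rw [hcl]
    exact crossSection_subset hθ
  obtain ⟨m₀, h₀⟩ := hmax θb (by constructor <;> linarith [hθs.1])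
  obtain ⟨m₁, h₁⟩ := hmax (θb + θs) (by constructor <;> linarith [hθs.1])
  obtain ⟨m₂, h₂⟩ := hmax (θb + 2 * θs) (by constructor <;> linarith [hθs.1])
  refine ⟨m₀, m₁, m₂, h₀, h₁, h₂, ?_⟩
  have hm0 : 0 ≤ m₀ := by
    obtain ⟨z, -, hz⟩ := h₀.1
    exact hz ▸ le_max_left _ _
  obtain ⟨x, hx, hxm⟩ := h₁.1
  -- Raising the exponent by `ε` makes the condition on `s` strict, and raising the bound by `ε`
  -- makes it positive even when both maxima are zero.
  have hε : ∀ ε : ℝ, 0 < ε → m₁ ≤ etaStar rs d₀ θs d (s + ε) * (max m₀ m₂ + ε) := by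
    intro ε hε
    have hmpos : 0 < max m₀ m₂ + ε := by linarith [le_max_left m₀ m₂]
    rw [← hxm]
    -- Positivity of `η` handles the value 0 in the positive part, leaving only the bound on `u x`.
    refine max_le (mul_pos (etaStar_pos hd₀ hR hd (by linarith)) hmpos).le ?_
    refine le_etaStar_mul_of_strict hcurves hθb hd₀ hθs hinside hA hb hd hdR (by linarith) ?_ hu
      hmpos (fun z hz => ?_) (fun z hz => ?_) hx
    · nlinarith [mul_pos hε hA.c_pos]
    · have := (le_max_right 0 (u z)).trans (h₀.2 ⟨z, hz, rfl⟩)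
      linarith [le_max_left m₀ m₂]
    · have := (le_max_right 0 (u z)).trans (h₂.2 ⟨z, hz, rfl⟩)
      linarith [le_max_right m₀ m₂]
  have hcont : Continuous fun ε : ℝ => etaStar rs d₀ θs d (s + ε) * (max m₀ m₂ + ε) :=
    ((continuous_etaStar hd₀ hR hd).comp (continuous_const.add continuous_id)).mul
      (continuous_const.add continuous_id)
  have hlim : Tendsto (fun ε : ℝ => etaStar rs d₀ θs d (s + ε) * (max m₀ m₂ + ε)) (𝓝[>] 0)
      (𝓝 (etaStar rs d₀ θs d s * max m₀ m₂)) := by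
    simpa using (hcont.tendsto 0).mono_left nhdsWithin_le_nhds
  exact ge_of_tendsto hlim (by filter_upwards [self_mem_nhdsWithin] with ε h using hε ε h)

end Growth

theorem lemma3p5
    (θ₀ rs : ℝ) (r₁ r₂ : ℝ → ℝ) (hcurves : SpiralCurves θ₀ rs r₁ r₂)
    (θb d₀ θs : ℝ) (hθb : θ₀ ≤ θb) (hd₀ : 0 < d₀) (hθs : θs ∈ Ioo 0 (Real.pi / 2))
    (hinside : ∀ θ ∈ Icc θb (θb + 2 * θs), r₂ θ ≤ rs + d₀)
    (hcos : Real.cos θs < rs / (rs + d₀))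
    (Ω γt : Set (EuclideanSpace ℝ (Fin 2)))
    (hΩ : Ω = spiralPiece r₁ r₂ (Ioo θb (θb + 2 * θs)))
    (hγt : γt = spiralBoundary θ₀ r₁ r₂ ∩ spiralPieceClosed r₁ r₂ (Icc θb (θb + 2 * θs)))
    (A : EuclideanSpace ℝ (Fin 2) → Matrix (Fin 2) (Fin 2) ℝ)
    (b : EuclideanSpace ℝ (Fin 2) → EuclideanSpace ℝ (Fin 2))
    (c₀ M₁ M₂ : ℝ) (hA : EllipticOn A Ω c₀ M₁) (hb : DriftBoundedOn b Ω M₂) :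
    (∃ η ∈ Ioo (0 : ℝ) 1, ∀ u : EuclideanSpace ℝ (Fin 2) → ℝ, SubsolutionOn A b Ω γt u →
      GrowthIneq u (crossSection r₁ r₂ θb) (crossSection r₁ r₂ (θb + θs))
        (crossSection r₁ r₂ (θb + 2 * θs)) η) ∧
    (∀ d s : ℝ,
      max ((rs + d₀) * (1 / Real.cos θs - 1))
        (d₀ ^ 2 / (2 * ((rs + d₀) * (1 - Real.cos θs) - d₀))) ≤ d →
      0 < s → (M₁ + M₂ * (rs + d₀ + d)) / c₀ - 2 ≤ s →
      0 < etaStar rs d₀ θs d s ∧ etaStar rs d₀ θs d s ≤ 1 ∧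
      (d₀ ^ 2 / (2 * ((rs + d₀) * (1 - Real.cos θs) - d₀)) < d →
        etaStar rs d₀ θs d s < 1) ∧
      ∀ u : EuclideanSpace ℝ (Fin 2) → ℝ, SubsolutionOn A b Ω γt u →
        GrowthIneq u (crossSection r₁ r₂ θb) (crossSection r₁ r₂ (θb + θs))
          (crossSection r₁ r₂ (θb + 2 * θs)) (etaStar rs d₀ θs d s)) := by
  subst hΩ hγt
  have hrs := hcurves.radius_pos
  have hR : 0 < rs + d₀ := by linarith
  have hpos := sub_pos_of_cos_lt hrs hd₀ hcos
  have hc : 0 < Real.cos θs :=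
    Real.cos_pos_of_mem_Ioo ⟨by linarith [hθs.1, Real.pi_pos], hθs.2⟩
  have hc0 := hA.c_pos
  have key : ∀ d s : ℝ,
      max ((rs + d₀) * (1 / Real.cos θs - 1))
        (d₀ ^ 2 / (2 * ((rs + d₀) * (1 - Real.cos θs) - d₀))) ≤ d →
      0 < s → (M₁ + M₂ * (rs + d₀ + d)) / c₀ - 2 ≤ s →
      0 < etaStar rs d₀ θs d s ∧ etaStar rs d₀ θs d s ≤ 1 ∧
      (d₀ ^ 2 / (2 * ((rs + d₀) * (1 - Real.cos θs) - d₀)) < d →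
        etaStar rs d₀ θs d s < 1) ∧
      ∀ u : EuclideanSpace ℝ (Fin 2) → ℝ,
        SubsolutionOn A b (spiralPiece r₁ r₂ (Ioo θb (θb + 2 * θs)))
          (spiralBoundary θ₀ r₁ r₂ ∩ spiralPieceClosed r₁ r₂ (Icc θb (θb + 2 * θs))) u →
        GrowthIneq u (crossSection r₁ r₂ θb) (crossSection r₁ r₂ (θb + θs))
          (crossSection r₁ r₂ (θb + 2 * θs)) (etaStar rs d₀ θs d s) := by
    intro d s hd hs hsl
    obtain ⟨hd1, hd2⟩ := max_le_iff.mp hd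
    have hdpos : 0 < d := lt_of_lt_of_le (by positivity) hd2
    refine ⟨etaStar_pos hd₀ hR hdpos hs, etaStar_le_one hd₀ hpos hdpos hd2 hs,
      fun h => etaStar_lt_one hd₀ hpos hdpos h hs, fun u hu => ?_⟩
    refine growthIneq_etaStar hcurves hθb hd₀ hθs hinside hA hb hdpos ?_ hs ?_ hu
    · have h1 : (rs + d₀) / Real.cos θs ≤ rs + d₀ + d := by
        have : (rs + d₀) / Real.cos θs = (rs + d₀) * (1 / Real.cos θs - 1) + (rs + d₀) := by ring
        linarith
      exact (div_le_iff₀ hc).mp h1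
    · exact (div_le_iff₀ hc0).mp (by linarith)
  refine ⟨?_, key⟩
  -- Taking `d = D + 1` exceeds the second threshold strictly, which gives `η < 1`.
  set D := max ((rs + d₀) * (1 / Real.cos θs - 1))
    (d₀ ^ 2 / (2 * ((rs + d₀) * (1 - Real.cos θs) - d₀))) with hD
  obtain ⟨h1, -, h2, h3⟩ := key (D + 1)
    (max 1 ((M₁ + M₂ * (rs + d₀ + (D + 1))) / c₀ - 2)) (by linarith)
    (lt_of_lt_of_le one_pos (le_max_left _ _)) (le_max_right _ _)
  have hlt : d₀ ^ 2 / (2 * ((rs + d₀) * (1 - Real.cos θs) - d₀)) < D + 1 :=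
    (le_max_right _ _).trans_lt (lt_add_one D)
  exact ⟨_, ⟨h1, h2 hlt⟩, h3⟩
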